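/- For a finite group $G$, let $G^{\mathscr{U}}$ denote the supersolvable residual of $G$, i.e. the intersection of all normal subgroups $N$ of $G$ such that $G/N$ is supersolvable. Put $$N_{\mathscr{U}}(G)=\bigcap_{T\le G}N_G(T^{\mathscr{U}}),$$ and define the ascending series $N^0_{\mathscr{U}}(G)=1$, $N^{i+1}_{\mathscr{U}}(G)/N^i_{\mathscr{U}}(G)=N_{\mathscr{U}}(G/N^i_{\mathscr{U}}(G))$; let $N^\infty_{\mathscr{U}}(G)$ be its terminal term. For a prime $p$ and a $p$-solvable finite group $G$, the $p$-length $l_p(G)$ is the number $n$ of $p$-factors $P_i(G)/M_{i-1}(G)$ $(1\le i\le n)$ in the upper $p$-series $$1=P_0(G)\le M_0(G)\le P_1(G)\le M_1(G)\le\cdots\le P_n(G)\le M_n(G)=G,$$ where $M_i(G)/P_i(G)=O_{p'}(G/P_i(G))$, $P_i(G)/M_{i-1}(G)=O_p(G/M_{i-1}(G))$ and $n$ is the least index with $M_n(G)=G$. **Theorem.** Let $G$ be a finite solvable group and $p$ a prime. If every cyclic subgroup of $G$ of order $p$, and, when $p=2$, also every cyclic subgroup of $G$ of order $4$, is contained in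 $N^\infty_{\mathscr{U}}(G)$, then $l_p(G)\le 2$. -/

import Mathlib

namespace WeakNorm

/-- `G` is supersolvable: there is a finite chain `1 = N₀ ≤ N₁ ≤ ⋯ ≤ Nₙ = G` of normal subgroups
of `G` all of whose factors `Nᵢ₊₁ / Nᵢ` (as subgroups of `G / Nᵢ`) are cyclic. -/
def IsSupersolvable (G : Type*) [Group G] : Prop :=
  ∃ (n : ℕ) (N : ℕ → Subgroup G) (_ : ∀ i, (N i).Normal),
    N 0 = ⊥ ∧ N n = ⊤ ∧
      ∀ i < n, N i ≤ N (i + 1) ∧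
        IsCyclic ((N (i + 1)).map (QuotientGroup.mk' (N i)))

theorem IsSupersolvable.of_equiv {G H : Type*} [Group G] [Group H] (e : G ≃* H)
    (h : IsSupersolvable G) : IsSupersolvable H := by
  obtain ⟨n, N, hN, h0, h1, hs⟩ := h
  have hN' : ∀ i, ((N i).map (e : G →* H)).Normal := fun i => (hN i).map _ e.surjective
  refine ⟨n, fun i => (N i).map (e : G →* H), hN', by simp [h0], ?_, fun i hi => ?_⟩
  · simp only [h1]
    exact Subgroup.map_top_of_surjective _ e.surjective
  · refine ⟨Subgroup.map_mono (hs i hi).1, ?_⟩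
    have hc := (hs i hi).2
    let q := QuotientGroup.congr (N i) ((N i).map (e : G →* H)) e rfl
    have key : ((N (i + 1)).map (e : G →* H)).map
        (QuotientGroup.mk' ((N i).map (e : G →* H))) =
        ((N (i + 1)).map (QuotientGroup.mk' (N i))).map (q : _ →* _) := by
      rw [Subgroup.map_map, Subgroup.map_map]
      rfl
    rw [key]
    exact isCyclic_of_surjective
      ((q : G ⧸ N i →* _).subgroupMap ((N (i + 1)).map (QuotientGroup.mk' (N i))))
      (MonoidHom.subgroupMap_surjective _ _)

/-- The supersolvable residual `G^𝒰`: the intersection of all normal subgroups `N` of `G` such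
that `G / N` is supersolvable. -/
def supersolvableResidual (G : Type*) [Group G] : Subgroup G :=
  sInf {N : Subgroup G | ∃ _ : N.Normal, IsSupersolvable (G ⧸ N)}

/-- The supersolvable residual `T^𝒰` of a subgroup `T` of `G`, as a subgroup of `G`. -/
def residualOf {G : Type*} [Group G] (T : Subgroup G) : Subgroup G :=
  (supersolvableResidual T).map T.subtype

/-- The norm `N_𝒰(G)`: the intersection of the normalizers in `G` of the supersolvable residuals
of all subgroups of `G`. -/
def normU (G : Type*) [Group G] : Subgroup G :=
  ⨅ T : Subgroup G, Subgroup.normalizer (residualOf T : Set G)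

theorem map_supersolvableResidual_le {G H : Type*} [Group G] [Group H] (e : G ≃* H) :
    (supersolvableResidual G).map (e : G →* H) ≤ supersolvableResidual H := by
  refine le_sInf ?_
  rintro N ⟨hN, hs⟩
  rw [Subgroup.map_le_iff_le_comap]
  refine sInf_le ⟨hN.comap _, ?_⟩
  refine hs.of_equiv (QuotientGroup.congr _ _ e ?_).symm
  exact Subgroup.map_comap_eq_self_of_surjective e.surjective N

theorem map_residualOf_conj_le {G : Type*} [Group G] (g : G) (T : Subgroup G) :
    (residualOf T).map (MulAut.conj g : G →* G) ≤
      residualOf (T.map (MulAut.conj g : G →* G)) := by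
  have h := map_supersolvableResidual_le ((MulAut.conj g).subgroupMap T)
  rintro _ ⟨_, ⟨x, hx, rfl⟩, rfl⟩
  exact ⟨_, h ⟨x, hx, rfl⟩, rfl⟩

theorem conj_mem_residualOf_iff {G : Type*} [Group G] (g x : G) (T : Subgroup G) :
    g * x * g⁻¹ ∈ residualOf (T.map (MulAut.conj g : G →* G)) ↔ x ∈ residualOf T := by
  constructor
  · intro h
    have h2 := map_residualOf_conj_le g⁻¹ _ ⟨_, h, rfl⟩
    rw [Subgroup.map_map] at h2
    have e1 : ((MulAut.conj g⁻¹ : G ≃* G) : G →* G).comp ((MulAut.conj g : G ≃* G) : G →* G) =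
        MonoidHom.id G := by
      ext y
      simp [mul_assoc]
    rw [e1, Subgroup.map_id] at h2
    simpa [mul_assoc] using h2
  · intro h
    exact map_residualOf_conj_le g T ⟨x, h, rfl⟩

instance normU_normal (G : Type*) [Group G] : (normU G).Normal := by
  refine ⟨fun x hx g => ?_⟩
  simp only [normU, Subgroup.mem_iInf, Subgroup.mem_normalizer_iff] at hx ⊢
  intro T y
  have h := hx (T.map (MulAut.conj g⁻¹ : G →* G)) (g⁻¹ * y * g)
  have c : ∀ z : G, g⁻¹ * z * g ∈ residualOf (T.map (MulAut.conj g⁻¹ : G →* G)) ↔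
      z ∈ residualOf T := fun z => by
    simpa using conj_mem_residualOf_iff g⁻¹ z T
  rw [c, ← conj_mem_residualOf_iff g⁻¹ (g * x * g⁻¹ * y * (g * x * g⁻¹)⁻¹)] at *
  rw [h]
  simp [mul_assoc]

/-- The terms `N^i_𝒰(G)`, bundled with their normality: `N^0_𝒰(G) = 1`, and `N^(i+1)_𝒰(G)` is the
preimage in `G` of `N_𝒰(G / N^i_𝒰(G))`. -/
def normUSeriesAux (G : Type*) [Group G] : ℕ → {N : Subgroup G // N.Normal}
  | 0 => ⟨⊥, inferInstance⟩
  | i + 1 =>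
    let N := normUSeriesAux G i
    haveI := N.2
    ⟨(normU (G ⧸ N.1)).comap (QuotientGroup.mk' N.1), inferInstance⟩

/-- The term `N^i_𝒰(G)` of the ascending series of `G`. -/
def normUSeries (G : Type*) [Group G] (i : ℕ) : Subgroup G := (normUSeriesAux G i).1

/-- `N^∞_𝒰(G)`: the union of the ascending series `N^i_𝒰(G)`; for finite `G` this is
the term at which the series becomes stationary. -/
def normUInfty (G : Type*) [Group G] : Subgroup G := ⨆ i, normUSeries G i

/-- `O_p(G)`: the join of all normal `p`-subgroups of `G`. -/
def pRadical (p : ℕ) (G : Type*) [Group G] : Subgroup G :=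
  sSup {N : Subgroup G | N.Normal ∧ IsPGroup p N}

/-- `O_{p'}(G)`: the join of all normal subgroups of `G` of order prime to `p`. -/
def pPrimeRadical (p : ℕ) (G : Type*) [Group G] : Subgroup G :=
  sSup {N : Subgroup G | N.Normal ∧ (Nat.card N).Coprime p}

instance pRadical_normal (p : ℕ) (G : Type*) [Group G] : (pRadical p G).Normal :=
  Subgroup.sSup_normal _ fun _ h => h.1

instance pPrimeRadical_normal (p : ℕ) (G : Type*) [Group G] : (pPrimeRadical p G).Normal :=
  Subgroup.sSup_normal _ fun _ h => h.1

/-- The normal subgroup `M` with `M / P = O_{p'}(G / P)`. -/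
def pPrimeStep (p : ℕ) {G : Type*} [Group G] (P : {N : Subgroup G // N.Normal}) :
    {N : Subgroup G // N.Normal} :=
  haveI := P.2
  ⟨(pPrimeRadical p (G ⧸ P.1)).comap (QuotientGroup.mk' P.1), inferInstance⟩

/-- The normal subgroup `P` with `P / M = O_p(G / M)`. -/
def pStep (p : ℕ) {G : Type*} [Group G] (M : {N : Subgroup G // N.Normal}) :
    {N : Subgroup G // N.Normal} :=
  haveI := M.2
  ⟨(pRadical p (G ⧸ M.1)).comap (QuotientGroup.mk' M.1), inferInstance⟩

/-- The terms `P_i(G)` of the upper `p`-series `1 = P₀ ≤ M₀ ≤ P₁ ≤ M₁ ≤ ⋯` of `G`, in which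
`M_i / P_i = O_{p'}(G / P_i)` and `P_{i+1} / M_i = O_p(G / M_i)`. -/
def upperP (p : ℕ) (G : Type*) [Group G] : ℕ → {N : Subgroup G // N.Normal}
  | 0 => ⟨⊥, inferInstance⟩
  | i + 1 => pStep p (pPrimeStep p (upperP p G i))

/-- The terms `M_i(G)` of the upper `p`-series of `G`. -/
def upperM (p : ℕ) (G : Type*) [Group G] (i : ℕ) : {N : Subgroup G // N.Normal} :=
  pPrimeStep p (upperP p G i)

/-- The `p`-length `l_p(G)`: the least `n` such that `M_n(G) = G`, that is, the number of factors
`P_i / M_{i-1}` in the upper `p`-series when it is stopped at `G`. The value is `⊤` if the upper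
`p`-series never reaches `G`, that is, if the finite group `G` is not `p`-solvable. -/
noncomputable def pLength (p : ℕ) (G : Type*) [Group G] : ℕ∞ :=
  ⨅ (n : ℕ) (_ : (upperM p G n).1 = ⊤), (n : ℕ∞)

end WeakNorm

namespace WeakNorm

/-! Passing to the quotient by `O_{p'}(G)` is harmless: elements of order `p` or `4` lift through a
kernel of order prime to `p`, and epimorphisms map `N^∞` into `N^∞`. So let `O_{p'}(G) = 1` and `P =
O_p(G)`; solvability gives `C_G(P) ≤ P`.

The norm enters through a minimal normal `p`-subgroup `V` of `G` inside `N_𝒰(G)`. When `C = C_G(V) ≠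
G`, a Frattini argument yields `T` with `T ∩ V = 1` and `TC = G`. Since `V` normalizes `T^𝒰`, we get
`[T^𝒰, V] ≤ T ∩ V = 1`, hence `T^𝒰 ≤ C` and `G/C` is supersolvable
(`supersolvableAbove_centralizer`). Induction on `|G|` extends this to any normal `p`-subgroup `W ≤
N^∞`: some `D` with `G/D` supersolvable has all its `p'`-elements centralizing `W`
(`exists_supersolvableAbove_centralizing`).

Take `W = P ∩ N^∞`, which contains all elements of `P` of order `p` (and `4` if `p = 2`). A
`p'`-automorphism of a `p`-group fixing those elements is trivial (`apply_eq_self_of_coprime`), so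
`p'`-elements of `D` lie in `C_G(P) ≤ P` and are trivial. Thus `D` is a `p`-group, `D ≤ P`, and
`G/P` is supersolvable. Its derived subgroup is nilpotent, so it has `p`-length at most 1; with `P`
this gives 2. -/

open QuotientGroup

/-! ### Supersolvable quotients and the residual -/

/-- `A` is a normal subgroup of `G` which is joined to `G` by a finite chain of normal subgroups
with cyclic factors; equivalently, `G / A` is supersolvable. -/
inductive SupersolvableAbove {G : Type*} [Group G] : Subgroup G → Prop
  | top : SupersolvableAbove ⊤
  | step {A B : Subgroup G} (hA : A.Normal) (hAB : A ≤ B) (hc : IsCyclic (B.map (mk' A)))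
      (hB : SupersolvableAbove B) : SupersolvableAbove A

theorem SupersolvableAbove.normal {G : Type*} [Group G] {A : Subgroup G}
    (h : SupersolvableAbove A) : A.Normal := by
  cases h with
  | top => infer_instance
  | step hA => exact hA

/-- The map `f` induces an embedding of `B'/A'` into `B/A`. -/
theorem isCyclic_map_mk_of_comap {G H : Type*} [Group G] [Group H] (f : G →* H)
    {A' B' : Subgroup G} {A B : Subgroup H} [A'.Normal] [A.Normal]
    (hA : A' = B' ⊓ A.comap f) (hB : B' ≤ B.comap f) (hc : IsCyclic (B.map (mk' A))) :
    IsCyclic (B'.map (mk' A')) := by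
  have hle : A' ≤ A.comap f := hA ▸ inf_le_right
  let q : G ⧸ A' →* H ⧸ A := QuotientGroup.map A' A f hle
  have hq : ∀ x ∈ B'.map (mk' A'), q x ∈ B.map (mk' A) := by
    rintro _ ⟨b, hb, rfl⟩
    exact ⟨f b, hB hb, rfl⟩
  let g : B'.map (mk' A') →* B.map (mk' A) :=
    (q.comp (Subgroup.subtype _)).codRestrict _ fun x => hq x x.2
  refine isCyclic_of_injective g ((injective_iff_map_eq_one g).2 ?_)
  rintro ⟨_, b, hb, rfl⟩ h
  have h1 : ((f b : H) : H ⧸ A) = 1 := congrArg Subtype.val h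
  rw [QuotientGroup.eq_one_iff] at h1
  have h2 : b ∈ A' := by
    rw [hA]
    exact ⟨hb, h1⟩
  exact Subtype.ext ((QuotientGroup.eq_one_iff b).2 h2)

theorem isCyclic_map_mk_map {G H : Type*} [Group G] [Group H] {f : G →* H}
    {A B : Subgroup G} [A.Normal] [(A.map f).Normal] (hc : IsCyclic (B.map (mk' A))) :
    IsCyclic ((B.map f).map (mk' (A.map f))) := by
  let q : G ⧸ A →* H ⧸ A.map f := QuotientGroup.map A (A.map f) f (Subgroup.le_comap_map f A)
  have key : (B.map f).map (mk' (A.map f)) = (B.map (mk' A)).map q := by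
    rw [Subgroup.map_map, Subgroup.map_map]
    rfl
  rw [key]
  exact isCyclic_of_surjective (q.subgroupMap (B.map (mk' A))) (MonoidHom.subgroupMap_surjective _ _)

namespace SupersolvableAbove

variable {G H : Type*} [Group G] [Group H]

theorem comap (f : G →* H) {A : Subgroup H} (h : SupersolvableAbove A) :
    SupersolvableAbove (A.comap f) := by
  induction h with
  | top => exact top
  | @step A B hA hAB hc _ ih =>
    exact step (hA.comap f) (Subgroup.comap_mono hAB)
      (isCyclic_map_mk_of_comap f (inf_eq_right.2 (Subgroup.comap_mono hAB)).symm le_rfl hc) ih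

theorem map {f : G →* H} (hf : Function.Surjective f) {A : Subgroup G}
    (h : SupersolvableAbove A) : SupersolvableAbove (A.map f) := by
  induction h with
  | top => exact (Subgroup.map_top_of_surjective f hf).symm ▸ top
  | @step A B hA hAB hc _ ih =>
    have := hA.map f hf
    exact step this (Subgroup.map_mono hAB) (isCyclic_map_mk_map hc) ih

/-- Intersecting the chain above `B` with `A` gives a chain from `A ⊓ B` up to `A`, whose factors
embed in those of the original. This is what makes the quotient by the residual of a finite group
itself supersolvable. -/
theorem inf {A B : Subgroup G} (hA : SupersolvableAbove A) (hB : SupersolvableAbove B) :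
    SupersolvableAbove (A ⊓ B) := by
  induction hB with
  | top => simpa using hA
  | @step B C hB hBC hc _ ih =>
    have := hA.normal
    refine step inferInstance (inf_le_inf_left A hBC) ?_ ih
    refine isCyclic_map_mk_of_comap (MonoidHom.id G) ?_ inf_le_right hc
    rw [Subgroup.comap_id, inf_assoc, inf_eq_right.2 hBC]

theorem mono {A B : Subgroup G} [B.Normal] (hA : SupersolvableAbove A) (hAB : A ≤ B) :
    SupersolvableAbove B := by
  have h := (hA.map (mk'_surjective B)).comap (mk' B)
  rwa [Subgroup.comap_map_eq, ker_mk', sup_eq_right.2 hAB] at h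

theorem sInf [Finite G] (S : Set (Subgroup G)) (hS : ∀ N ∈ S, SupersolvableAbove N) :
    SupersolvableAbove (sInf S) := by
  induction S, Set.toFinite S using Set.Finite.induction_on with
  | empty => simpa using top
  | insert _ _ ih =>
    rw [sInf_insert]
    exact (hS _ (Set.mem_insert _ _)).inf (ih fun N hN => hS N (Set.mem_insert_of_mem _ hN))

theorem exists_chain {A : Subgroup G} (h : SupersolvableAbove A) :
    ∃ (n : ℕ) (N : ℕ → Subgroup G) (_ : ∀ i, (N i).Normal), N 0 = A ∧ N n = ⊤ ∧
      ∀ i < n, N i ≤ N (i + 1) ∧ IsCyclic ((N (i + 1)).map (mk' (N i))) := by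
  induction h with
  | top => exact ⟨0, fun _ => ⊤, fun _ => inferInstance, rfl, rfl, by simp⟩
  | @step A B hA hAB hc _ ih =>
    obtain ⟨n, N, hN, rfl, h1, hs⟩ := ih
    refine ⟨n + 1, fun i => i.casesOn A N, fun i => ?_, rfl, h1, fun i hi => ?_⟩
    · cases i with
      | zero => exact hA
      | succ i => exact hN i
    · cases i with
      | zero => exact ⟨hAB, hc⟩
      | succ i => exact hs i (by omega)

end SupersolvableAbove

theorem IsSupersolvable.supersolvableAbove_bot {G : Type*} [Group G] (h : IsSupersolvable G) :
    SupersolvableAbove (⊥ : Subgroup G) := by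
  obtain ⟨n, N, hN, h0, h1, hs⟩ := h
  have key : ∀ k i, i + k = n → SupersolvableAbove (N i) := by
    intro k
    induction k with
    | zero =>
      rintro i rfl
      rw [add_zero] at h1
      exact h1 ▸ .top
    | succ k ih =>
      intro i hi
      exact .step (hN i) (hs i (by omega)).1 (hs i (by omega)).2 (ih (i + 1) (by omega))
  exact h0 ▸ key n 0 (zero_add n)

theorem isSupersolvable_quotient_iff {G : Type*} [Group G] (N : Subgroup G) [N.Normal] :
    IsSupersolvable (G ⧸ N) ↔ SupersolvableAbove N := by
  constructor
  · intro h
    have := h.supersolvableAbove_bot.comap (mk' N)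
    rwa [MonoidHom.comap_bot, ker_mk'] at this
  · intro h
    have := h.map (mk'_surjective N)
    rw [map_mk'_self] at this
    exact this.exists_chain

theorem supersolvableResidual_le {G : Type*} [Group G] {N : Subgroup G}
    (h : SupersolvableAbove N) : supersolvableResidual G ≤ N :=
  have := h.normal
  sInf_le ⟨this, (isSupersolvable_quotient_iff N).2 h⟩

theorem supersolvableAbove_residual (G : Type*) [Group G] [Finite G] :
    SupersolvableAbove (supersolvableResidual G) :=
  SupersolvableAbove.sInf _ fun N ⟨_, h⟩ => (isSupersolvable_quotient_iff N).1 h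

theorem map_supersolvableResidual {G H : Type*} [Group G] [Group H] [Finite G] {f : G →* H}
    (hf : Function.Surjective f) :
    (supersolvableResidual G).map f = supersolvableResidual H := by
  have := Finite.of_surjective f hf
  refine le_antisymm ?_ (supersolvableResidual_le ((supersolvableAbove_residual G).map hf))
  rw [Subgroup.map_le_iff_le_comap]
  exact supersolvableResidual_le ((supersolvableAbove_residual H).comap f)

theorem map_residualOf_comap {G H : Type*} [Group G] [Group H] [Finite G] {f : G →* H}
    (hf : Function.Surjective f) (T : Subgroup H) :
    (residualOf (T.comap f)).map f = residualOf T := by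
  have hs : Function.Surjective (f.subgroupComap T) := by
    rintro ⟨t, ht⟩
    obtain ⟨g, rfl⟩ := hf t
    exact ⟨⟨g, ht⟩, rfl⟩
  rw [residualOf, residualOf, ← map_supersolvableResidual hs, Subgroup.map_map, Subgroup.map_map]
  rfl

/-! ### The norm and its series under epimorphisms -/

theorem map_normU_le {G H : Type*} [Group G] [Group H] [Finite G] {f : G →* H}
    (hf : Function.Surjective f) : (normU G).map f ≤ normU H := by
  rintro _ ⟨g, hg, rfl⟩
  refine Subgroup.mem_iInf.2 fun T => ?_
  have h := Subgroup.mem_map_of_mem f (Subgroup.mem_iInf.1 hg (T.comap f))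
  rw [← map_residualOf_comap hf T]
  exact Subgroup.le_normalizer_map f h

theorem normUSeries_zero (G : Type*) [Group G] : normUSeries G 0 = ⊥ := rfl

instance normUSeries_normal (G : Type*) [Group G] (i : ℕ) : (normUSeries G i).Normal :=
  (normUSeriesAux G i).2

theorem normUSeries_succ (G : Type*) [Group G] (i : ℕ) :
    normUSeries G (i + 1) = (normU (G ⧸ normUSeries G i)).comap (mk' (normUSeries G i)) := rfl

theorem map_normUSeries_le {G H : Type*} [Group G] [Group H] [Finite G] {f : G →* H}
    (hf : Function.Surjective f) (i : ℕ) : (normUSeries G i).map f ≤ normUSeries H i := by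
  induction i with
  | zero => simp [normUSeries_zero]
  | succ i ih =>
    rw [normUSeries_succ, normUSeries_succ]
    let q : G ⧸ normUSeries G i →* H ⧸ normUSeries H i :=
      QuotientGroup.map _ _ f (Subgroup.map_le_iff_le_comap.1 ih)
    have hq : Function.Surjective q :=
      map_surjective_of_surjective _ _ f ((mk'_surjective _).comp hf) _
    rintro _ ⟨x, hx, rfl⟩
    exact map_normU_le hq ⟨_, hx, rfl⟩

theorem map_normUInfty_le {G H : Type*} [Group G] [Group H] [Finite G] {f : G →* H}
    (hf : Function.Surjective f) : (normUInfty G).map f ≤ normUInfty H := by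
  rw [normUInfty, Subgroup.map_iSup]
  exact iSup_le fun i => (map_normUSeries_le hf i).trans (le_iSup (normUSeries H) i)

theorem normUInfty_eq_bot {G : Type*} [Group G] [Finite G] (h : normU G = ⊥) :
    normUInfty G = ⊥ := by
  refine iSup_eq_bot.2 fun i => ?_
  induction i with
  | zero => rfl
  | succ i ih =>
    rw [eq_bot_iff, normUSeries_succ, ← h]
    intro x hx
    -- The term of index `i` is trivial, so the quotient maps back onto `G` and its norm lands in
    -- `normU G = ⊥`.
    let e : G ⧸ normUSeries G i →* G :=
      QuotientGroup.lift (normUSeries G i) (MonoidHom.id G) (by rw [ih]; simp)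
    exact map_normU_le (f := e) (fun g => ⟨g, rfl⟩) ⟨_, hx, rfl⟩

open scoped commutatorElement

/-! ### Coprime automorphisms of `p`-groups -/

section CoprimeAction

theorem mul_pow_of_commute_commutator {G : Type*} [Group G] {a b : G} (ha : Commute ⁅b, a⁆ a)
    (hb : Commute ⁅b, a⁆ b) (n : ℕ) : (a * b) ^ n = a ^ n * b ^ n * ⁅b, a⁆ ^ n.choose 2 := by
  have hswap : ∀ n : ℕ, b ^ n * a = ⁅b, a⁆ ^ n * a * b ^ n := by
    intro n
    induction n with
    | zero => simp
    | succ n ih =>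
      have h1 : b * a = ⁅b, a⁆ * a * b := by simp [commutatorElement_def]
      calc b ^ (n + 1) * a = b ^ n * (b * a) := by rw [pow_succ, mul_assoc]
        _ = (b ^ n * ⁅b, a⁆) * a * b := by rw [h1]; simp only [mul_assoc]
        _ = ⁅b, a⁆ * (b ^ n * a) * b := by rw [← (hb.pow_right n).eq]; simp only [mul_assoc]
        _ = ⁅b, a⁆ ^ (n + 1) * a * b ^ (n + 1) := by
          rw [ih, pow_succ', pow_succ b]; simp only [mul_assoc]
  induction n with
  | zero => simp
  | succ n ih =>
    have hz : ∀ m, Commute (⁅b, a⁆ ^ m) (a * b) := fun m => (ha.mul_right hb).pow_left m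
    have hb' : Commute (⁅b, a⁆ ^ n) (b ^ (n + 1)) := (hb.pow_right _).pow_left _
    have ha' : Commute (⁅b, a⁆ ^ n) a := ha.pow_left n
    calc (a * b) ^ (n + 1) = a ^ n * b ^ n * (⁅b, a⁆ ^ n.choose 2 * (a * b)) := by
          rw [pow_succ, ih, mul_assoc]
      _ = a ^ n * (b ^ n * a) * b * ⁅b, a⁆ ^ n.choose 2 := by
          rw [(hz _).eq]; simp only [mul_assoc]
      _ = a ^ n * (⁅b, a⁆ ^ n * a) * (b ^ n * b) * ⁅b, a⁆ ^ n.choose 2 := by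
          rw [hswap]; simp only [mul_assoc]
      _ = a ^ n * a * (⁅b, a⁆ ^ n * b ^ (n + 1)) * ⁅b, a⁆ ^ n.choose 2 := by
          rw [ha'.eq, ← pow_succ]; simp only [mul_assoc]
      _ = a ^ (n + 1) * b ^ (n + 1) * ⁅b, a⁆ ^ (n + 1).choose 2 := by
          rw [hb'.eq, Nat.choose_succ_succ, Nat.choose_one_right, pow_add ⁅b, a⁆, pow_succ a, pow_succ b]
          simp only [mul_assoc]

theorem iterate_eq_mul_pow {P : Type*} [Group P] (φ : P →* P) {y u : P} (hy : φ y = y * u)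
    (hu : φ u = u) (n : ℕ) : φ^[n] y = y * u ^ n := by
  induction n with
  | zero => simp
  | succ n ih =>
    rw [Function.iterate_succ_apply', ih, map_mul, map_pow, hy, hu, pow_succ', mul_assoc]

/-- With `u = y⁻¹ φ(y)` fixed, iteration gives `y = φⁿ(y) = y uⁿ`; so `uⁿ = 1`, while `u` has
`p`-power order prime to `n`. -/
theorem apply_eq_of_apply_inv_mul {P : Type*} [Group P] {p n : ℕ} (hP : IsPGroup p P)
    (hn : p.Coprime n) (φ : P →* P) (hφ : ∀ y, φ^[n] y = y) {y : P}
    (hu : φ (y⁻¹ * φ y) = y⁻¹ * φ y) : φ y = y := by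
  have h := iterate_eq_mul_pow φ (mul_inv_cancel_left y (φ y)).symm hu n
  rw [hφ, left_eq_mul] at h
  have h1 := hP.orderOf_coprime hn (y⁻¹ * φ y)
  have h2 := h1.eq_one_of_dvd (orderOf_dvd_of_pow_eq_one h)
  rw [orderOf_eq_one_iff, inv_mul_eq_one] at h2
  exact h2.symm

/-- The subgroup generated by the commutators and the `p`-th powers. -/
def commutatorPow (p : ℕ) (P : Type*) [Group P] : Subgroup P :=
  (powMonoidHom p : Abelianization P →* Abelianization P).range.comap Abelianization.of

theorem map_mem_commutatorPow {p : ℕ} {P : Type*} [Group P] (φ : P →* P) {y : P}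
    (hy : y ∈ commutatorPow p P) : φ y ∈ commutatorPow p P := by
  obtain ⟨z, hz⟩ := hy
  refine ⟨Abelianization.map φ z, ?_⟩
  rw [powMonoidHom_apply] at hz ⊢
  rw [← map_pow, hz, Abelianization.map_of]

theorem pow_mem_commutatorPow (p : ℕ) {P : Type*} [Group P] (y : P) :
    y ^ p ∈ commutatorPow p P :=
  ⟨Abelianization.of y, by simp⟩

theorem commutator_mem_commutatorPow (p : ℕ) {P : Type*} [Group P] (a b : P) :
    ⁅a, b⁆ ∈ commutatorPow p P :=
  ⟨1, by simp [commutatorElement_def]⟩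

/-- Otherwise the `p`-th power map would be surjective, hence injective, on the nontrivial finite
`p`-group `P/P'`, which has an element of order `p`. -/
theorem commutatorPow_ne_top {p : ℕ} [hp : Fact p.Prime] {P : Type*} [Group P] [Finite P]
    [Nontrivial P] (hP : IsPGroup p P) : commutatorPow p P ≠ ⊤ := by
  intro h
  have hsol : Group.IsSolvable P := by
    have := hP.isNilpotent
    infer_instance
  have hof : Function.Surjective (Abelianization.of : P →* Abelianization P) :=
    QuotientGroup.mk_surjective
  have hA : IsPGroup p (Abelianization P) := hP.of_surjective _ hof
  have hfin : Finite (Abelianization P) := Finite.of_surjective _ hof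
  have hsurj : Function.Surjective (powMonoidHom p : Abelianization P →* Abelianization P) := by
    intro x
    obtain ⟨y, rfl⟩ := hof x
    exact (h ▸ Subgroup.mem_top y : y ∈ commutatorPow p P)
  have hinj := Finite.injective_iff_surjective.2 hsurj
  have hnt : Nontrivial (Abelianization P) := by
    by_contra hcon
    rw [not_nontrivial_iff_subsingleton] at hcon
    refine (Group.IsSolvable.commutator_lt_top_of_nontrivial P).ne (eq_top_iff.2 fun x _ => ?_)
    rw [← Abelianization.ker_of]
    exact Subsingleton.elim _ _
  have hdvd : p ∣ Nat.card (Abelianization P) := by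
    rcases hA.card_eq_or_dvd with h1 | h1
    · exact absurd h1 (Finite.one_lt_card).ne'
    · exact h1
  obtain ⟨x, hx⟩ := exists_prime_orderOf_dvd_card' p hdvd
  have hx1 : x = 1 := hinj (by simp [← hx, pow_orderOf_eq_one])
  rw [hx1, orderOf_one] at hx
  exact hp.1.one_lt.ne hx

/-- By induction `φ` is trivial on proper invariant subgroups, in particular on `F = P' P^p`. Then
every `y⁻¹ φ(y)` centralizes `F`. If `C_P(F)` is proper it is fixed pointwise; otherwise `F` is
central, `P` has class at most 2, and `y⁻¹ φ(y)` has order dividing `p`, or `4` when `p = 2`. Either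
way `y⁻¹ φ(y)` is fixed. -/
theorem apply_eq_self_of_coprime {p n : ℕ} [hp : Fact p.Prime] (hn : p.Coprime n)
    {P : Type*} [Group P] [Finite P] (hP : IsPGroup p P) (φ : P →* P) (hφ : ∀ y, φ^[n] y = y)
    (h1 : ∀ y, y ^ p = 1 → φ y = y) (h4 : p = 2 → ∀ y, y ^ 4 = 1 → φ y = y) (y : P) :
    φ y = y := by
  induction hk : Nat.card P using Nat.strong_induction_on generalizing P with
  | _ k ih =>
  subst hk
  rcases subsingleton_or_nontrivial P with _ | _
  · exact Subsingleton.elim _ _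
  have hsub : ∀ K : Subgroup P, K ≠ ⊤ → (∀ x ∈ K, φ x ∈ K) → ∀ x ∈ K, φ x = x := by
    intro K hK hinv x hx
    let ψ : K →* K := (φ.comp K.subtype).codRestrict K fun x => hinv x x.2
    have hψ : ∀ (m : ℕ) (z : K), ((ψ^[m] z : K) : P) = φ^[m] z := by
      intro m z
      induction m with
      | zero => rfl
      | succ m ihm =>
        rw [Function.iterate_succ_apply', Function.iterate_succ_apply', ← ihm]
        rfl
    have hcard : Nat.card K < Nat.card P :=
      lt_of_le_of_ne (Subgroup.card_le_card_group K) fun h => hK (Subgroup.eq_top_of_card_eq K h)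
    have := ih _ hcard (hP.to_subgroup K) ψ (fun z => Subtype.ext (by rw [hψ, hφ]))
      (fun z hz => Subtype.ext (h1 z (by rw [← Subgroup.coe_pow, hz, Subgroup.coe_one])))
      (fun h2 z hz => Subtype.ext (h4 h2 z (by rw [← Subgroup.coe_pow, hz, Subgroup.coe_one])))
      ⟨x, hx⟩ rfl
    exact congrArg Subtype.val this
  have hF := hsub _ (commutatorPow_ne_top hP) fun x hx => map_mem_commutatorPow φ hx
  refine apply_eq_of_apply_inv_mul hP hn φ hφ ?_
  have hnorm : (commutatorPow p P).Normal := by unfold commutatorPow; infer_instance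
  have hcent : ∀ y, y⁻¹ * φ y ∈ Subgroup.centralizer (commutatorPow p P : Set P) := by
    intro y c hc
    have e1 := hF _ (hnorm.conj_mem c hc y)
    rw [map_mul, map_mul, map_inv, hF c hc] at e1
    have e2 : φ y * c = y * c * y⁻¹ * φ y := by rw [← e1]; group
    calc c * (y⁻¹ * φ y) = y⁻¹ * (y * c * y⁻¹ * φ y) := by group
      _ = y⁻¹ * φ y * c := by rw [← e2]; group
  by_cases hE : Subgroup.centralizer (commutatorPow p P : Set P) = ⊤
  swap
  · refine hsub _ hE (fun x hx => ?_) _ (hcent y)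
    have := mul_mem hx (hcent x)
    rwa [mul_inv_cancel_left] at this
  have hcomm : ∀ c ∈ commutatorPow p P, ∀ x, Commute c x := fun c hc x =>
    (Subgroup.mem_centralizer_iff.1 (hE ▸ Subgroup.mem_top x)) c hc
  set z := ⁅φ y, y⁻¹⁆ with hz
  have hzF : z ∈ commutatorPow p P := commutator_mem_commutatorPow p _ _
  have hpow : ∀ m, (y⁻¹ * φ y) ^ m = y⁻¹ ^ m * φ y ^ m * z ^ m.choose 2 := fun m =>
    mul_pow_of_commute_commutator (hcomm z hzF _) (hcomm z hzF _) m
  have hup : (y⁻¹ * φ y) ^ p = z ^ p.choose 2 := by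
    rw [hpow, ← map_pow, hF _ (pow_mem_commutatorPow p y), inv_pow, inv_mul_cancel, one_mul]
  -- Conjugating `y⁻ᵖ` by `φ y` multiplies it by `zᵖ`, yet `y⁻ᵖ` is central.
  have hzp : z ^ p = 1 := by
    have e1 : φ y * y⁻¹ * (φ y)⁻¹ = z * y⁻¹ := by rw [hz, commutatorElement_def]; group
    have e2 : φ y * y⁻¹ ^ p * (φ y)⁻¹ = z ^ p * y⁻¹ ^ p := by
      rw [← conj_pow, e1, (hcomm z hzF _).mul_pow]
    have hc := hcomm _ (pow_mem_commutatorPow p y⁻¹) (φ y)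
    rw [← hc.eq, mul_inv_cancel_right, right_eq_mul] at e2
    exact e2
  -- For odd `p`, `p` divides `p.choose 2`, which kills the power of `z`; for `p = 2` the exponent
  -- is 1, and a further squaring is needed.
  by_cases h2 : p = 2
  · refine h4 h2 _ ?_
    subst h2
    rw [show 4 = 2 * 2 from rfl, pow_mul, hup, Nat.choose_self, pow_one, hzp]
  · refine h1 _ ?_
    have hlt : 2 < p := lt_of_le_of_ne hp.1.two_le (Ne.symm h2)
    obtain ⟨m, hm⟩ := hp.1.dvd_choose_self two_ne_zero hlt
    rw [hup, hm, pow_mul, hzp, one_pow]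

end CoprimeAction

/-! ### The radicals `O_p` and `O_{p'}` -/

section Radicals

variable {G : Type*} [Group G]

theorem isPGroup_subgroup_iff {p : ℕ} {K : Subgroup G} :
    IsPGroup p K ↔ ∀ x ∈ K, ∃ k : ℕ, x ^ p ^ k = 1 := by
  rw [isPGroup_iff_pow_pow_eq_one]
  constructor
  · intro h x hx
    obtain ⟨k, hk⟩ := h ⟨x, hx⟩
    exact ⟨k, congrArg Subtype.val hk⟩
  · intro h x
    obtain ⟨k, hk⟩ := h x x.2
    exact ⟨k, Subtype.ext hk⟩

theorem le_pRadical {p : ℕ} {N : Subgroup G} (hN : N.Normal) (h : IsPGroup p N) :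
    N ≤ pRadical p G :=
  le_sSup ⟨hN, h⟩

theorem le_pPrimeRadical {p : ℕ} {N : Subgroup G} (hN : N.Normal) (h : (Nat.card N).Coprime p) :
    N ≤ pPrimeRadical p G :=
  le_sSup ⟨hN, h⟩

theorem isPGroup_pRadical (p : ℕ) : IsPGroup p (pRadical p G) := by
  obtain ⟨S⟩ : Nonempty (Sylow p G) := inferInstance
  refine S.2.to_le (sSup_le ?_)
  rintro N ⟨hN, h⟩
  exact sup_eq_right.1 (S.3 (h.to_sup_of_normal_left S.2) le_sup_right)

theorem pRadical_quotient_pStep (p : ℕ) (M : {N : Subgroup G // N.Normal}) :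
    haveI := (pStep p M).2
    pRadical p (G ⧸ (pStep p M).1) = ⊥ := by
  have := M.2
  have := (pStep p M).2
  set P := (pStep p M).1 with hP
  have hPdef : P = (pRadical p (G ⧸ M.1)).comap (mk' M.1) := rfl
  set Y := (pRadical p (G ⧸ P)).comap (mk' P) with hY
  suffices h : Y ≤ P by
    rwa [← Subgroup.map_comap_eq_self_of_surjective (mk'_surjective P) (pRadical p (G ⧸ P)),
      Subgroup.map_eq_bot_iff, ker_mk']
  rw [hPdef, ← Subgroup.map_le_iff_le_comap]
  refine le_pRadical ((inferInstance : Y.Normal).map _ (mk'_surjective _))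
    (isPGroup_subgroup_iff.2 ?_)
  rintro _ ⟨y, hy, rfl⟩
  obtain ⟨k, hk⟩ := isPGroup_subgroup_iff.1 (isPGroup_pRadical p) _ hy
  rw [← map_pow] at hk
  have h1 : y ^ p ^ k ∈ P := (QuotientGroup.eq_one_iff _).1 hk
  rw [hPdef] at h1
  obtain ⟨j, hj⟩ := isPGroup_subgroup_iff.1 (isPGroup_pRadical p) _ h1
  refine ⟨k + j, ?_⟩
  rw [pow_add, pow_mul, ← map_pow, hj]

variable [Finite G]

theorem exists_minimal_normal {X : Subgroup G} (hX : X.Normal) (hX1 : X ≠ ⊥) :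
    ∃ V ≤ X, V.Normal ∧ V ≠ ⊥ ∧ ∀ N : Subgroup G, N.Normal → N ≤ V → N = ⊥ ∨ N = V := by
  obtain ⟨V, hV⟩ := (Set.toFinite {N : Subgroup G | N.Normal ∧ N ≠ ⊥ ∧ N ≤ X}).exists_minimal
    ⟨X, hX, hX1, le_rfl⟩
  refine ⟨V, hV.prop.2.2, hV.prop.1, hV.prop.2.1, fun N hN hNV => or_iff_not_imp_left.2 fun h => ?_⟩
  exact le_antisymm hNV (hV.le_of_le ⟨hN, h, hNV.trans hV.prop.2.2⟩ hNV)

theorem coprime_card_iff {p : ℕ} [hp : Fact p.Prime] {K : Subgroup G} :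
    (Nat.card K).Coprime p ↔ ∀ x ∈ K, x ^ p = 1 → x = 1 := by
  rw [Nat.coprime_comm, hp.1.coprime_iff_not_dvd]
  constructor
  · intro h x hx hxp
    by_contra hx1
    exact h (orderOf_eq_prime hxp hx1 ▸ Subgroup.orderOf_dvd_natCard K hx)
  · intro h hdvd
    obtain ⟨x, hx⟩ := exists_prime_orderOf_dvd_card' p hdvd
    have h1 : x = 1 := Subtype.ext
      (h x x.2 (by rw [← Subgroup.coe_pow, ← hx, pow_orderOf_eq_one, Subgroup.coe_one]))
    rw [h1, orderOf_one] at hx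
    exact hp.1.one_lt.ne hx

theorem coprime_card_pPrimeRadical (p : ℕ) : (Nat.card (pPrimeRadical p G)).Coprime p := by
  have key : ∀ S : Set (Subgroup G), (∀ N ∈ S, N.Normal ∧ (Nat.card N).Coprime p) →
      (Nat.card (sSup S : Subgroup G)).Coprime p := by
    intro S hS
    induction S, Set.toFinite S using Set.Finite.induction_on with
    | empty => simp
    | @insert N S _ _ ih =>
      rw [sSup_insert]
      have hN := hS N (Set.mem_insert _ _)
      have := hN.1
      have h1 := ih fun N hN => hS N (Set.mem_insert_of_mem _ hN)
      have h2 : (N.relIndex (sSup S)).Coprime p := h1.coprime_dvd_left (Subgroup.relIndex_dvd_card _ _)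
      have h3 := Subgroup.relIndex_mul_relIndex ⊥ N (N ⊔ sSup S) bot_le le_sup_left
      rw [Subgroup.relIndex_bot_left, Subgroup.relIndex_bot_left, Subgroup.relIndex_sup_left] at h3
      rw [← h3]
      exact hN.2.mul_left h2
  exact key _ fun N hN => hN

theorem normal_map_sylow {N : Subgroup G} [hN : N.Normal] [Group.IsNilpotent N] {q : ℕ}
    [Fact q.Prime] (S : Sylow q N) : ((S : Subgroup N).map N.subtype).Normal := by
  have hS : (S : Subgroup N).Normal :=
    ((Group.isNilpotent_of_finite_tfae (G := N)).out 0 3 :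
      Group.IsNilpotent N ↔ ∀ (p : ℕ) (_ : Fact p.Prime) (P : Sylow p N), P.Normal).1 ‹_› q ‹_› S
  have := S.characteristic_of_normal hS
  infer_instance

/-- Sylow subgroups of `N` are characteristic, hence normal in `G`; those for primes other than `p`
lie in `O_{p'}(G) = 1`. -/
theorem le_pRadical_of_isNilpotent {p : ℕ} [hp : Fact p.Prime] (hO : pPrimeRadical p G = ⊥)
    (N : Subgroup G) [hN : N.Normal] [Group.IsNilpotent N] : N ≤ pRadical p G := by
  refine le_pRadical hN (IsPGroup.of_card (Nat.eq_prime_pow_of_unique_prime_dvd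
    Nat.card_pos.ne' fun {q} hq hqN => ?_))
  by_contra hqp
  have : Fact q.Prime := ⟨hq⟩
  obtain ⟨S⟩ : Nonempty (Sylow q N) := inferInstance
  have hle : (S : Subgroup N).map N.subtype ≤ pPrimeRadical p G := by
    refine le_pPrimeRadical (normal_map_sylow S) ?_
    obtain ⟨n, hn⟩ := IsPGroup.iff_card.1 (S.2.map N.subtype)
    rw [hn]
    exact ((Nat.coprime_primes hq hp.1).2 hqp).pow_left n
  rw [hO, le_bot_iff, Subgroup.map_eq_bot_iff_of_injective _ N.subtype_injective] at hle
  exact S.ne_bot_of_dvd_card hqN hle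

theorem exists_normal_isPGroup_le [Group.IsSolvable G] {X : Subgroup G} (hX : X.Normal)
    (hX1 : X ≠ ⊥) : ∃ q : ℕ, q.Prime ∧ ∃ Y ≤ X, Y.Normal ∧ Y ≠ ⊥ ∧ IsPGroup q Y := by
  obtain ⟨V, hVX, hV, hV1, hmin⟩ := exists_minimal_normal hX hX1
  have hlt := Group.IsSolvable.commutator_lt_of_ne_bot hV1
  have hbot : ⁅V, V⁆ = ⊥ := (hmin _ inferInstance hlt.le).resolve_right hlt.ne
  have : Group.IsNilpotent V := Subgroup.isNilpotent_of_lowerCentralSeries_eq_bot (n := 1) hbot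
  have hcard : Nat.card V ≠ 1 := fun h => hV1 (Subgroup.card_eq_one.1 h)
  obtain ⟨q, hq, hqV⟩ := Nat.exists_prime_and_dvd hcard
  have : Fact q.Prime := ⟨hq⟩
  obtain ⟨S⟩ : Nonempty (Sylow q V) := inferInstance
  refine ⟨q, hq, _, (Subgroup.map_subtype_le _).trans hVX, normal_map_sylow S, fun h => ?_,
    S.2.map _⟩
  rw [Subgroup.map_eq_bot_iff_of_injective _ V.subtype_injective] at h
  exact S.ne_bot_of_dvd_card hqV h

/-- If `C = C_G(P)` were not inside `P`, then `C/Z` with `Z = C ∩ P` would contain a nontrivial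
normal `q`-subgroup of `G/Z`. Its preimage is a central extension by `Z` of a `q`-group, hence
nilpotent, hence in `P` and so in `Z`: a contradiction. -/
theorem centralizer_pRadical_le [Group.IsSolvable G] {p : ℕ} [hp : Fact p.Prime]
    (hO : pPrimeRadical p G = ⊥) :
    Subgroup.centralizer (pRadical p G : Set G) ≤ pRadical p G := by
  set P := pRadical p G with hP
  set C := Subgroup.centralizer (P : Set G) with hC
  let Z := C ⊓ P
  by_contra hcon
  have hne : C.map (mk' Z) ≠ ⊥ := by
    rw [Ne, (Subgroup.map_eq_bot_iff _), ker_mk']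
    exact fun h => hcon (h.trans inf_le_right)
  obtain ⟨q, hq, Y, hYC, hY, hY1, hYq⟩ :=
    exists_normal_isPGroup_le ((inferInstance : C.Normal).map _ (mk'_surjective Z)) hne
  have : Fact q.Prime := ⟨hq⟩
  have hLC : Y.comap (mk' Z) ≤ C := by
    refine (Subgroup.comap_mono hYC).trans ?_
    rw [Subgroup.comap_map_eq, ker_mk']
    exact sup_le le_rfl inf_le_left
  have hnil : Group.IsNilpotent (Y.comap (mk' Z)) := by
    have := hYq.isNilpotent
    refine Subgroup.isNilpotent_of_ker_le_center ((mk' Z).subgroupComap Y) ?_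
    intro x hx
    have hxZ : (x : G) ∈ Z := (QuotientGroup.eq_one_iff _).1 (congrArg Subtype.val hx)
    refine Subgroup.mem_center_iff.2 fun y => Subtype.ext ?_
    exact (Subgroup.mem_centralizer_iff.1 (hLC y.2) x hxZ.2).symm
  have hLP := le_pRadical_of_isNilpotent hO (Y.comap (mk' Z))
  refine hY1 ?_
  rw [← Subgroup.map_comap_eq_self_of_surjective (mk'_surjective Z) Y, Subgroup.map_eq_bot_iff,
    ker_mk']
  exact le_inf hLC hLP

theorem pPrimeRadical_quotient_pPrimeStep (p : ℕ) [hp : Fact p.Prime]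
    (P : {N : Subgroup G // N.Normal}) :
    haveI := (pPrimeStep p P).2
    pPrimeRadical p (G ⧸ (pPrimeStep p P).1) = ⊥ := by
  have := P.2
  have := (pPrimeStep p P).2
  set M := (pPrimeStep p P).1 with hM
  have hMdef : M = (pPrimeRadical p (G ⧸ P.1)).comap (mk' P.1) := rfl
  set Y := (pPrimeRadical p (G ⧸ M)).comap (mk' M) with hY
  suffices h : Y ≤ M by
    rwa [← Subgroup.map_comap_eq_self_of_surjective (mk'_surjective M) (pPrimeRadical p (G ⧸ M)),
      Subgroup.map_eq_bot_iff, ker_mk']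
  rw [hMdef, ← Subgroup.map_le_iff_le_comap]
  refine le_pPrimeRadical ((inferInstance : Y.Normal).map _ (mk'_surjective _))
    (coprime_card_iff.2 ?_)
  rintro _ ⟨y, hy, rfl⟩ hyp
  have hPM : P.1 ≤ M := by
    rw [hMdef, ← Subgroup.map_le_iff_le_comap, map_mk'_self]
    exact bot_le
  rw [← map_pow] at hyp
  have h1 : y ^ p ∈ M := hPM ((QuotientGroup.eq_one_iff _).1 hyp)
  have h2 : mk' M y = 1 := coprime_card_iff.1 (coprime_card_pPrimeRadical p) _ hy
    (by rw [← map_pow]; exact (QuotientGroup.eq_one_iff _).2 h1)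
  have h3 : y ∈ M := (QuotientGroup.eq_one_iff _).1 h2
  rw [hMdef] at h3
  exact coprime_card_iff.1 (coprime_card_pPrimeRadical p) _ h3 (by rw [← map_pow, hyp])

end Radicals

/-! ### Action on `p`-subgroups of the norm -/

theorem mul_comm_of_disjoint_of_normalizes {G : Type*} [Group G] {A B : Subgroup G}
    (hd : A ⊓ B = ⊥) {a b : G} (ha : a ∈ A) (hb : b ∈ B) (h1 : b * a * b⁻¹ ∈ A)
    (h2 : a * b * a⁻¹ ∈ B) : a * b = b * a := by
  have h : b * a * b⁻¹ * a⁻¹ ∈ A ⊓ B := by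
    refine ⟨A.mul_mem h1 (A.inv_mem ha), ?_⟩
    have : b * (a * b * a⁻¹)⁻¹ ∈ B := mul_mem hb (inv_mem h2)
    simpa [mul_assoc] using this
  rw [hd, Subgroup.mem_bot, mul_inv_eq_one, mul_inv_eq_iff_eq_mul] at h
  exact h.symm

theorem exists_ne_one_commute_of_isPGroup {G : Type*} [Group G] [Finite G] {p : ℕ}
    [hp : Fact p.Prime] {V S : Subgroup G} [V.Normal] (hV1 : V ≠ ⊥) (hV : IsPGroup p V)
    (hS : IsPGroup p S) : ∃ v ∈ V, v ≠ 1 ∧ ∀ s ∈ S, s * v = v * s := by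
  let : MulAction S V := MulAction.compHom V ((MulAut.conjNormal (H := V)).comp S.subtype)
  have hsmul : ∀ (s : S) (v : V), ((s • v : V) : G) = s * v * (s : G)⁻¹ := fun s v => rfl
  have hdvd : p ∣ Nat.card V :=
    hV.card_eq_or_dvd.resolve_left fun h => hV1 (Subgroup.card_eq_one.1 h)
  have h1 : (1 : V) ∈ MulAction.fixedPoints S V := fun s => Subtype.ext (by rw [hsmul]; simp)
  obtain ⟨v, hv, hv1⟩ := hS.exists_fixed_point_of_prime_dvd_card_of_fixed_point V hdvd h1
  refine ⟨v, v.2, fun h => hv1 (Subtype.ext h.symm), fun s hs => ?_⟩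
  have := congrArg Subtype.val (hv ⟨s, hs⟩)
  rw [hsmul] at this
  exact mul_inv_eq_iff_eq_mul.1 this

/-- The relative index of `SC` in `R` divides both that of `C`, a power of `q`, and that of `S`,
prime to `q`. -/
theorem le_sylow_map_sup {G : Type*} [Group G] [Finite G] {q : ℕ} [hq : Fact q.Prime]
    {C R : Subgroup G} [C.Normal] (hCR : IsPGroup q (R.map (mk' C))) (S : Sylow q R) :
    R ≤ (S : Subgroup R).map R.subtype ⊔ C := by
  rw [← Subgroup.relIndex_eq_one]
  obtain ⟨n, hn⟩ := IsPGroup.iff_card.1 hCR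
  have h1 := Subgroup.relIndex_dvd_of_le_left R
    (le_sup_right : C ≤ (S : Subgroup R).map R.subtype ⊔ C)
  have h2 := Subgroup.relIndex_dvd_of_le_left R
    (le_sup_left : (S : Subgroup R).map R.subtype ≤ (S : Subgroup R).map R.subtype ⊔ C)
  have h3 : C.relIndex R = q ^ n := by
    rw [← hn, ← Subgroup.relIndex_ker, ker_mk']
  have h4 : ((S : Subgroup R).map R.subtype).relIndex R = (S : Subgroup R).index := by
    rw [Subgroup.relIndex, Subgroup.subgroupOf,
      Subgroup.comap_map_eq_self_of_injective R.subtype_injective]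
  rw [h3] at h1
  rw [h4] at h2
  have hcop : (q ^ n).Coprime (S : Subgroup R).index :=
    ((Nat.Prime.coprime_iff_not_dvd hq.1).2 S.not_dvd_index).pow_left n
  exact Nat.eq_one_of_dvd_coprimes hcop h1 h2

theorem supersolvableAbove_centralizer_of_supplement {G : Type*} [Group G] [Finite G]
    {V : Subgroup G} [hV : V.Normal] (hVU : V ≤ normU G) {T : Subgroup G}
    (hTV : T ⊓ V = ⊥) (hTC : T ⊔ Subgroup.centralizer (V : Set G) = ⊤) :
    SupersolvableAbove (Subgroup.centralizer (V : Set G)) := by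
  set C := Subgroup.centralizer (V : Set G) with hC
  have hTle : residualOf T ≤ T := Subgroup.map_subtype_le _
  have hd : residualOf T ⊓ V = ⊥ := le_bot_iff.1 (hTV ▸ inf_le_inf_right V hTle)
  have hres : residualOf T ≤ C := by
    intro d hd'
    refine Subgroup.mem_centralizer_iff.2 fun v hv => ?_
    refine (mul_comm_of_disjoint_of_normalizes hd hd' hv ?_ (hV.conj_mem v hv d)).symm
    exact (Subgroup.mem_normalizer_iff.1 (Subgroup.mem_iInf.1 (hVU hv) T) d).1 hd'
  have h1 : SupersolvableAbove (C.subgroupOf T) :=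
    (supersolvableAbove_residual T).mono (Subgroup.map_le_iff_le_comap.1 hres)
  let f : T →* G ⧸ C := (mk' C).comp T.subtype
  have hf : Function.Surjective f := by
    rw [← MonoidHom.range_eq_top, MonoidHom.range_comp, Subgroup.range_subtype]
    have := congrArg (Subgroup.map (mk' C)) hTC
    rwa [Subgroup.map_sup, map_mk'_self, sup_bot_eq,
      Subgroup.map_top_of_surjective _ (mk'_surjective C)] at this
  have h2 : (C.subgroupOf T).map f = ⊥ := by
    rw [Subgroup.map_eq_bot_iff]
    intro x hx
    exact (QuotientGroup.eq_one_iff _).2 hx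
  have h3 := (h1.map hf).comap (mk' C)
  rwa [h2, MonoidHom.comap_bot, ker_mk'] at h3

/-- The supplement is `T = N_G(S)`, with `S` a Sylow `q`-subgroup of `R` and `R/C` a nontrivial
normal `q`-subgroup of `G/C`. By minimality of `V`, `R` has no nontrivial fixed points on `V`, and
since `R ≤ SC` neither has `S`. Hence `q ≠ p`, and `[T ∩ V, S] ≤ S ∩ V = 1` forces `T ∩ V = 1`. The
Frattini argument gives `TC = G`. -/
theorem supersolvableAbove_centralizer {G : Type*} [Group G] [Finite G] [Group.IsSolvable G]
    {p : ℕ} [hp : Fact p.Prime] {V : Subgroup G} [hV : V.Normal] (hV1 : V ≠ ⊥)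
    (hmin : ∀ N : Subgroup G, N.Normal → N ≤ V → N = ⊥ ∨ N = V) (hVp : IsPGroup p V)
    (hVU : V ≤ normU G) : SupersolvableAbove (Subgroup.centralizer (V : Set G)) := by
  by_cases hCtop : Subgroup.centralizer (V : Set G) = ⊤
  · exact hCtop ▸ .top
  set C := Subgroup.centralizer (V : Set G) with hC
  have hne : (⊤ : Subgroup (G ⧸ C)) ≠ ⊥ := by
    intro h
    rw [← Subgroup.map_top_of_surjective _ (mk'_surjective C), Subgroup.map_eq_bot_iff, ker_mk',
      top_le_iff] at h
    exact hCtop h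
  obtain ⟨q, hq, Y, -, hY, hY1, hYq⟩ := exists_normal_isPGroup_le inferInstance hne
  have : Fact q.Prime := ⟨hq⟩
  set R := Y.comap (mk' C) with hR
  have hRmap : R.map (mk' C) = Y := Subgroup.map_comap_eq_self_of_surjective (mk'_surjective C) Y
  have hF : V ⊓ Subgroup.centralizer (R : Set G) = ⊥ := by
    refine (hmin _ inferInstance inf_le_left).resolve_right fun h => hY1 ?_
    rw [inf_eq_left, Subgroup.le_centralizer_iff] at h
    rw [← hRmap, Subgroup.map_eq_bot_iff, ker_mk']
    exact h
  obtain ⟨S⟩ : Nonempty (Sylow q R) := inferInstance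
  have hRS : R ≤ (S : Subgroup R).map R.subtype ⊔ C := le_sylow_map_sup (hRmap.symm ▸ hYq) S
  have hfix : ∀ v ∈ V, (∀ s ∈ (S : Subgroup R).map R.subtype, s * v = v * s) → v = 1 := by
    intro v hv hs
    have hle : (S : Subgroup R).map R.subtype ⊔ C ≤ Subgroup.centralizer {v} := by
      refine sup_le (fun s hs' => ?_) (fun c hc => ?_)
      · exact Subgroup.mem_centralizer_singleton_iff.2 (hs s hs')
      · exact Subgroup.mem_centralizer_singleton_iff.2 (Subgroup.mem_centralizer_iff.1 hc v hv).symm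
    have hmem : v ∈ V ⊓ Subgroup.centralizer (R : Set G) := ⟨hv, Subgroup.mem_centralizer_iff.2
      fun r hr => Subgroup.mem_centralizer_singleton_iff.1 (hle (hRS hr))⟩
    rwa [hF, Subgroup.mem_bot] at hmem
  have hSq : IsPGroup q ((S : Subgroup R).map R.subtype) := S.2.map _
  have hqp : q ≠ p := by
    rintro rfl
    obtain ⟨v, hv, hv1, hs⟩ := exists_ne_one_commute_of_isPGroup hV1 hVp hSq
    exact hv1 (hfix v hv hs)
  have hSV : (S : Subgroup R).map R.subtype ⊓ V = ⊥ :=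
    (IsPGroup.disjoint_of_ne q p hqp _ _ hSq hVp).eq_bot
  refine supersolvableAbove_centralizer_of_supplement hVU
    (T := Subgroup.normalizer ((S : Subgroup R).map R.subtype : Set G)) ?_ ?_
  · rw [eq_bot_iff]
    rintro v ⟨hvT, hv⟩
    refine hfix v hv fun s hs => ?_
    exact mul_comm_of_disjoint_of_normalizes hSV hs hv
      ((Subgroup.mem_normalizer_iff.1 hvT s).1 hs) (hV.conj_mem v hv s)
  · rw [eq_top_iff, ← Sylow.normalizer_sup_eq_top S]
    exact sup_le le_sup_left (hRS.trans (sup_le_sup_right Subgroup.le_normalizer _))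

theorem coe_iterate_conjNormal {G : Type*} [Group G] {W : Subgroup G} [W.Normal] (x : G) (n : ℕ)
    (w : W) : (((MulAut.conjNormal x : MulAut W) : W →* W)^[n] w : G) = x ^ n * w * (x ^ n)⁻¹ := by
  induction n with
  | zero => simp
  | succ n ih =>
    rw [Function.iterate_succ_apply', pow_succ']
    refine (MulAut.conjNormal_apply x _).trans ?_
    rw [ih]
    group

theorem iterate_conjNormal_orderOf {G : Type*} [Group G] {W : Subgroup G} [W.Normal] (x : G)
    (w : W) : ((MulAut.conjNormal x : MulAut W) : W →* W)^[orderOf x] w = w :=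
  Subtype.ext (by rw [coe_iterate_conjNormal, pow_orderOf_eq_one]; simp)

theorem conjNormal_apply_eq_self_iff {G : Type*} [Group G] {W : Subgroup G} [W.Normal] (x : G)
    (w : W) : ((MulAut.conjNormal x : MulAut W) : W →* W) w = w ↔ x * w = w * x := by
  rw [Subtype.ext_iff, MonoidHom.coe_coe, MulAut.conjNormal_apply, mul_inv_eq_iff_eq_mul]

theorem exists_supersolvableAbove_centralizing {p : ℕ} [hp : Fact p.Prime] {G : Type*} [Group G]
    [Finite G] [Group.IsSolvable G] {W : Subgroup G} (hW : W.Normal) (hWp : IsPGroup p W)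
    (hWU : W ≤ normUInfty G) :
    ∃ D : Subgroup G, SupersolvableAbove D ∧
      ∀ x ∈ D, p.Coprime (orderOf x) → ∀ w ∈ W, x * w = w * x := by
  induction hk : Nat.card G using Nat.strong_induction_on generalizing G with
  | _ k ih =>
  subst hk
  have ihq : ∀ N : Subgroup G, N.Normal → N ≠ ⊥ → ∃ D : Subgroup G, SupersolvableAbove D ∧
      ∀ x ∈ D, p.Coprime (orderOf x) → ∀ w ∈ W, (x * w)⁻¹ * (w * x) ∈ N := by
    intro N hN hN1
    have hcard : Nat.card (G ⧸ N) < Nat.card G := by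
      rw [Subgroup.card_eq_card_quotient_mul_card_subgroup N]
      exact lt_mul_of_one_lt_right Nat.card_pos (N.one_lt_card_iff_ne_bot.2 hN1)
    obtain ⟨D, hD, hDW⟩ := ih _ hcard (hW.map _ (mk'_surjective N)) (hWp.map (mk' N))
      ((Subgroup.map_mono hWU).trans (map_normUInfty_le (mk'_surjective N))) rfl
    refine ⟨D.comap (mk' N), hD.comap _, fun x hx hxp w hw => ?_⟩
    rw [← QuotientGroup.eq]
    exact hDW (mk' N x) hx (hxp.coprime_dvd_right (orderOf_map_dvd _ x)) _
      (Subgroup.mem_map_of_mem _ hw)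
  by_cases hW1 : W = ⊥
  · refine ⟨⊤, .top, fun x _ _ w hw => ?_⟩
    rw [hW1, Subgroup.mem_bot] at hw
    simp [hw]
  -- If the intersection is trivial, factoring out `normU G` loses nothing: commutators of `x` with
  -- `w` lie in `W ⊓ normU G`. Otherwise a minimal normal `V` inside it is factored out, and `D` is
  -- cut down to centralize `V`.
  by_cases hWN : W ⊓ normU G = ⊥
  · have hN1 : normU G ≠ ⊥ := fun h => hW1 (le_bot_iff.1 (normUInfty_eq_bot h ▸ hWU))
    obtain ⟨D, hD, hDW⟩ := ihq _ inferInstance hN1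
    refine ⟨D, hD, fun x hx hxp w hw => ?_⟩
    have h1 : (x * w)⁻¹ * (w * x) ∈ W ⊓ normU G := by
      refine ⟨?_, hDW x hx hxp w hw⟩
      have := mul_mem (inv_mem hw) (hW.conj_mem w hw x⁻¹)
      simpa [mul_assoc] using this
    rw [hWN, Subgroup.mem_bot] at h1
    exact inv_mul_eq_one.1 h1
  · obtain ⟨V, hVW, hV, hV1, hmin⟩ := exists_minimal_normal inferInstance hWN
    obtain ⟨D, hD, hDW⟩ := ihq V hV hV1
    refine ⟨_, hD.inf (supersolvableAbove_centralizer hV1 hmin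
      (hWp.to_le (hVW.trans inf_le_left)) (hVW.trans inf_le_right)), ?_⟩
    rintro x ⟨hxD, hxV⟩ hxp w hw
    rw [← conjNormal_apply_eq_self_iff x ⟨w, hw⟩]
    -- The element `w⁻¹ (x w x⁻¹)` lies in `V`, which `x` centralizes.
    refine apply_eq_of_apply_inv_mul hWp hxp _ (iterate_conjNormal_orderOf x) ?_
    rw [conjNormal_apply_eq_self_iff]
    refine (Subgroup.mem_centralizer_iff.1 hxV _ ?_).symm
    have h1 := hV.conj_mem _ (inv_mem (hDW x hxD hxp w hw)) x
    have h2 : x * ((x * w)⁻¹ * (w * x))⁻¹ * x⁻¹ = w⁻¹ * (x * w * x⁻¹) := by group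
    rwa [h2] at h1

/-! ### Nilpotency of the derived subgroup of a supersolvable group -/

/-- The automorphism group of a cyclic group is abelian, so conjugation on `N` kills commutators. -/
theorem commutator_le_centralizer_of_isCyclic {G : Type*} [Group G] {N : Subgroup G} [N.Normal]
    (hN : IsCyclic N) : commutator G ≤ Subgroup.centralizer (N : Set G) := by
  let c : G →* MulAut N := MulAut.conjNormal
  have hcomm : ∀ a b : MulAut N, a * b = b * a := by
    intro a b
    obtain ⟨m, hm⟩ := MonoidHom.map_cyclic (a : N →* N)
    refine MulEquiv.ext fun x => ?_
    have h1 : ∀ y, a y = y ^ m := hm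
    rw [MulAut.mul_apply, MulAut.mul_apply, h1, h1, map_zpow]
  rw [commutator_def, Subgroup.commutator_le]
  intro g _ h _
  refine Subgroup.mem_centralizer_iff.2 fun x hx => ?_
  have h1 : c ⁅g, h⁆ = 1 := by
    rw [map_commutatorElement, commutatorElement_eq_one_iff_mul_comm, hcomm]
  have h2 := congrArg (fun a : MulAut N => ((a ⟨x, hx⟩ : N) : G)) h1
  exact (mul_inv_eq_iff_eq_mul.1 h2).symm

theorem SupersolvableAbove.exists_lowerCentralSeries_le {G : Type*} [Group G] {A : Subgroup G}
    (h : SupersolvableAbove A) : ∃ n, (commutator G).lowerCentralSeries n ≤ A := by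
  induction h with
  | top => exact ⟨0, le_top⟩
  | @step A B hA hAB hc hB ih =>
    obtain ⟨n, hn⟩ := ih
    refine ⟨n + 1, ?_⟩
    rw [Subgroup.lowerCentralSeries_succ]
    refine (Subgroup.commutator_mono hn le_rfl).trans ?_
    have := hB.normal.map _ (mk'_surjective A)
    have hcent := commutator_le_centralizer_of_isCyclic hc
    rw [Subgroup.le_centralizer_iff, ← Subgroup.commutator_eq_bot_iff_le_centralizer] at hcent
    have hmap : (commutator G).map (mk' A) = commutator (G ⧸ A) := by
      rw [commutator_def, commutator_def, Subgroup.map_commutator,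
        Subgroup.map_top_of_surjective _ (mk'_surjective A)]
    rw [← hmap, ← Subgroup.map_commutator, Subgroup.map_eq_bot_iff, ker_mk'] at hcent
    exact hcent

theorem IsSupersolvable.isNilpotent_commutator {G : Type*} [Group G] (h : IsSupersolvable G) :
    Group.IsNilpotent (commutator G) := by
  obtain ⟨n, hn⟩ := h.supersolvableAbove_bot.exists_lowerCentralSeries_le
  exact Subgroup.isNilpotent_of_lowerCentralSeries_eq_bot (le_bot_iff.1 hn)

/-! ### Supersolvability modulo `O_p` and the `p`-length -/

theorem supersolvableAbove_pRadical {p : ℕ} [hp : Fact p.Prime] {G : Type*} [Group G]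
    [Finite G] [Group.IsSolvable G] (hO : pPrimeRadical p G = ⊥)
    (h1 : ∀ x : G, x ^ p = 1 → x ∈ normUInfty G)
    (h4 : p = 2 → ∀ x : G, x ^ 4 = 1 → x ∈ normUInfty G) :
    SupersolvableAbove (pRadical p G) := by
  have hPp : IsPGroup p (pRadical p G) := isPGroup_pRadical p
  have hnorm : (normUInfty G).Normal := by unfold normUInfty; infer_instance
  obtain ⟨D, hD, hDW⟩ := exists_supersolvableAbove_centralizing
    (W := pRadical p G ⊓ normUInfty G) inferInstance hPp.to_inf_left inf_le_right
  have hcent : ∀ x ∈ D, p.Coprime (orderOf x) → x = 1 := by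
    intro x hx hxp
    have hxC : x ∈ Subgroup.centralizer (pRadical p G : Set G) := by
      refine Subgroup.mem_centralizer_iff.2 fun w hw => ?_
      refine ((conjNormal_apply_eq_self_iff x ⟨w, hw⟩).1 ?_).symm
      refine apply_eq_self_of_coprime hxp hPp _ (iterate_conjNormal_orderOf x) ?_ ?_ _
      · intro y hy
        rw [conjNormal_apply_eq_self_iff]
        exact hDW x hx hxp y ⟨y.2, h1 y (congrArg Subtype.val hy)⟩
      · intro h2 y hy
        rw [conjNormal_apply_eq_self_iff]
        exact hDW x hx hxp y ⟨y.2, h4 h2 y (congrArg Subtype.val hy)⟩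
    obtain ⟨k, hk⟩ := isPGroup_subgroup_iff.1 hPp x (centralizer_pRadical_le hO hxC)
    exact orderOf_eq_one_iff.1
      (Nat.eq_one_of_dvd_coprimes (hxp.pow_left k) (orderOf_dvd_of_pow_eq_one hk) dvd_rfl)
  have hDp : IsPGroup p D := by
    refine isPGroup_subgroup_iff.2 fun x hx => ?_
    obtain ⟨k, m, hm, hkm⟩ :=
      Nat.exists_eq_pow_mul_and_not_dvd (orderOf_pos x).ne' p hp.1.ne_one
    refine ⟨k, hcent _ (pow_mem hx _) ?_⟩
    refine ((Nat.Prime.coprime_iff_not_dvd hp.1).2 hm).coprime_dvd_right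
      (orderOf_dvd_of_pow_eq_one ?_)
    rw [← pow_mul, ← hkm, pow_orderOf_eq_one]
  exact hD.mono (le_pRadical hD.normal hDp)

theorem exists_pow_eq_one_of_quotient {G : Type*} [Group G] [Finite G] {N : Subgroup G} [N.Normal]
    {n : ℕ} (hn : (Nat.card N).Coprime n) {x : G ⧸ N} (hx : x ^ n = 1) :
    ∃ y : G, y ^ n = 1 ∧ mk' N y = x := by
  obtain ⟨x, rfl⟩ := mk'_surjective N x
  obtain ⟨m, hm⟩ := exists_pow_eq_self_of_coprime
    (hn.coprime_dvd_right (orderOf_dvd_of_pow_eq_one hx))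
  -- The power `|N|` kills `xⁿ ∈ N`; `m` undoes it modulo `N`, inverting `|N|` modulo the order of
  -- the image of `x`.
  refine ⟨(x ^ Nat.card N) ^ m, ?_, by rw [map_pow, map_pow, hm]⟩
  have hxN : x ^ n ∈ N := (QuotientGroup.eq_one_iff _).1 (by rw [← map_pow] at hx; exact hx)
  have hc : (x ^ n) ^ Nat.card N = 1 :=
    orderOf_dvd_iff_pow_eq_one.1 (Subgroup.orderOf_dvd_natCard N hxN)
  rw [pow_right_comm, pow_right_comm x, hc, one_pow]

theorem coprime_card_upperM_zero {p : ℕ} [hp : Fact p.Prime] {G : Type*} [Group G] [Finite G] :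
    (Nat.card (upperM p G 0).1).Coprime p := by
  refine coprime_card_iff.2 fun x hx hxp => ?_
  have h1 : mk' (⊥ : Subgroup G) x = 1 :=
    coprime_card_iff.1 (coprime_card_pPrimeRadical p) (mk' (⊥ : Subgroup G) x) hx
      (by rw [← map_pow, hxp, map_one])
  exact Subgroup.mem_bot.1 ((QuotientGroup.eq_one_iff x).1 h1)

/-- Modulo `M` the derived subgroup is nilpotent and `O_{p'}` is trivial, so the derived subgroup
lies in `O_p`. The next quotient is abelian with `O_p = 1`, hence has no elements of order `p`. -/
theorem pPrimeStep_pStep_pPrimeStep_eq_top {p : ℕ} [hp : Fact p.Prime] {G : Type*} [Group G]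
    [Finite G] {P : {N : Subgroup G // N.Normal}} (hP : SupersolvableAbove P.1) :
    (pPrimeStep p (pStep p (pPrimeStep p P))).1 = ⊤ := by
  set M := pPrimeStep p P with hM
  have := P.2
  have := M.2
  have hPM : P.1 ≤ M.1 := by
    change P.1 ≤ (pPrimeRadical p (G ⧸ P.1)).comap (mk' P.1)
    rw [← Subgroup.map_le_iff_le_comap, map_mk'_self]
    exact bot_le
  have hO : pPrimeRadical p (G ⧸ M.1) = ⊥ := pPrimeRadical_quotient_pPrimeStep p P
  have := ((isSupersolvable_quotient_iff M.1).2 (hP.mono hPM)).isNilpotent_commutator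
  have hle : commutator (G ⧸ M.1) ≤ pRadical p (G ⧸ M.1) := le_pRadical_of_isNilpotent hO _
  have := (pStep p M).2
  have hcomm : ∀ x y : G ⧸ (pStep p M).1, x * y = y * x := by
    intro x y
    obtain ⟨x, rfl⟩ := mk'_surjective _ x
    obtain ⟨y, rfl⟩ := mk'_surjective _ y
    have h1 : ⁅x, y⁆ ∈ (pStep p M).1 := by
      change mk' M.1 ⁅x, y⁆ ∈ pRadical p (G ⧸ M.1)
      rw [map_commutatorElement]
      exact hle (Subgroup.commutator_mem_commutator (Subgroup.mem_top _) (Subgroup.mem_top _))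
    rw [← commutatorElement_eq_one_iff_mul_comm, ← map_commutatorElement]
    exact (QuotientGroup.eq_one_iff _).2 h1
  have hR : pRadical p (G ⧸ (pStep p M).1) = ⊥ := pRadical_quotient_pStep p M
  have htop : pPrimeRadical p (G ⧸ (pStep p M).1) = ⊤ := by
    refine top_le_iff.1 (le_pPrimeRadical inferInstance (coprime_card_iff.2 fun x _ hx => ?_))
    have hxn : (Subgroup.zpowers x).Normal := ⟨fun n hn g => by
      rwa [hcomm g n, mul_inv_cancel_right]⟩
    have hxR : Subgroup.zpowers x ≤ pRadical p _ := le_pRadical hxn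
      (isPGroup_subgroup_iff.2 ?_)
    · rw [hR] at hxR
      exact Subgroup.mem_bot.1 (hxR (Subgroup.mem_zpowers x))
    · rintro _ ⟨k, rfl⟩
      refine ⟨1, ?_⟩
      change (x ^ k) ^ p ^ 1 = 1
      rw [pow_one, ← zpow_natCast, zpow_comm, zpow_natCast, hx, one_zpow]
  change (pPrimeRadical p (G ⧸ (pStep p M).1)).comap _ = ⊤
  rw [htop, Subgroup.comap_top]

end WeakNorm

theorem theorem5p7 (G : Type*) [Group G] [Finite G] (hG : Group.IsSolvable G) (p : ℕ) (hp : p.Prime)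
    (h : ∀ C : Subgroup G, IsCyclic C →
      (Nat.card C = p ∨ (p = 2 ∧ Nat.card C = 4)) → C ≤ WeakNorm.normUInfty G) :
    WeakNorm.pLength p G ≤ 2 := by
  have : Fact p.Prime := ⟨hp⟩
  have h1 : ∀ x : G, x ^ p = 1 → x ∈ WeakNorm.normUInfty G := by
    intro x hx
    by_cases hx1 : x = 1
    · exact hx1 ▸ one_mem _
    refine h (Subgroup.zpowers x) inferInstance (Or.inl ?_) (Subgroup.mem_zpowers x)
    rw [Nat.card_zpowers, orderOf_eq_prime hx hx1]
  have h4 : p = 2 → ∀ x : G, x ^ 4 = 1 → x ∈ WeakNorm.normUInfty G := by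
    rintro rfl x hx
    by_cases hx2 : x ^ 2 = 1
    · exact h1 x hx2
    refine h (Subgroup.zpowers x) inferInstance (Or.inr ⟨rfl, ?_⟩) (Subgroup.mem_zpowers x)
    rw [Nat.card_zpowers]
    exact orderOf_eq_prime_pow (p := 2) (n := 1) hx2 hx
  set M := WeakNorm.upperM p G 0 with hM
  have := M.2
  have hcop : (Nat.card M.1).Coprime p := WeakNorm.coprime_card_upperM_zero
  have hss : WeakNorm.SupersolvableAbove (WeakNorm.pRadical p (G ⧸ M.1)) := by
    refine WeakNorm.supersolvableAbove_pRadical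
      (WeakNorm.pPrimeRadical_quotient_pPrimeStep p _) (fun x hx => ?_) (fun h2 x hx => ?_)
    · obtain ⟨y, hy, rfl⟩ := WeakNorm.exists_pow_eq_one_of_quotient hcop hx
      exact WeakNorm.map_normUInfty_le (QuotientGroup.mk'_surjective M.1) ⟨y, h1 y hy, rfl⟩
    · have hcop4 : (Nat.card M.1).Coprime 4 := by
        have := hcop.pow_right 2
        rwa [h2] at this
      obtain ⟨y, hy, rfl⟩ := WeakNorm.exists_pow_eq_one_of_quotient hcop4 hx
      exact WeakNorm.map_normUInfty_le (QuotientGroup.mk'_surjective M.1) ⟨y, h4 h2 y hy, rfl⟩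
  have htop : (WeakNorm.upperM p G 2).1 = ⊤ :=
    -- `P₁` is the preimage of `O_p(G/M₀)`, so `G/P₁` is supersolvable and the series reaches `G` at
    -- `M₂`.
    WeakNorm.pPrimeStep_pStep_pPrimeStep_eq_top (P := WeakNorm.upperP p G 1)
      (hss.comap (QuotientGroup.mk' M.1))
  exact iInf₂_le 2 htop
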